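/- Let $G$ be a graph on the vertex set $V=\{0,\dots,n-1\}$, whose edges are called positive and whose non-adjacent pairs of distinct vertices are called negative edges. For a clustering $\ell:V\to\mathbb N$ (the clusters are the sets of vertices with equal label) let $\mathrm{cost}(\ell)$ be the number of negative edges inside clusters plus the number of positive edges between different clusters, and let $\mathrm{OPT}$ be the minimum cost of a clustering of $G$. Algorithm QECC with query budget $Q$ (a positive integer) works as follows. Start with $R=V$. While $R\neq\emptyset$ and $Q\ge |R|-1$: pick a pivot $v\in R$ uniformly at random; query all pairs $\{v,w\}$ with $w\in R\setminus\{v\}$, which reveals whether they are positive; replace $Q$ by $Q-|R|+1$; output the cluster $C=\{v\}\cup\{w\in R: \{v,w\}\text{ is a positive edge}\}$; replace $R$ by $R\setminus C$. When the loop ends, output a singleton cluster for each remaining $v\in R$. Theorem. For every graph $G$ on $n$ vertices and every integer $Q>0$, QECC with budget $Q$ always makes at most $Q$ edge queries, and the clustering that it outputs has expected cost at most $$3\cdot \mathrm{OPT}+\frac{n^3}{2Q}.$$ Moreover QECC runs in time $O(Q)$ with unit-cost queries: there are a constant $C$ and a single program for a random access machine (registers and memory over $\mathbb N$; addition, truncated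 subtraction, comparison, memory access, drawing a uniformly random element of $\{0,\dots,m-1\}$, and an edge query each take one unit of time; $n$ and $Q$ are given in registers, everything else is initially $0$) such that for all $n$, all $Q>0$ and all graphs $G$ on $n$ vertices every run of the program halts within $C\cdot Q$ steps, and the output clustering together with the multiset of queried pairs has the same joint distribution as for QECC. Here the output is the array of labels in memory, in which a vertex whose cell was never written has its own name as its label, and every other vertex is labelled by the pivot of its cluster (so that remaining singletons need not be written out). -/

import Mathlib

open scoped ENNReal

/-! ### Correlation clustering -/

namespace CorrClust

/- The input is the complete graph on `Fin n` with every edge labelled positive or negative. Its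
positive edges form a `SimpleGraph (Fin n)`; the negative edges are the remaining pairs of distinct
vertices. A clustering is a labelling `Fin n → ℕ`; its clusters are the sets of vertices with the
same label. -/

open Classical in
/-- The number of disagreements of the clustering `l` with `G`: negative edges inside clusters plus
positive edges between clusters. -/
noncomputable def cost {n : ℕ} (G : SimpleGraph (Fin n)) (l : Fin n → ℕ) : ℕ :=
  (Finset.univ.filter fun p : Fin n × Fin n =>
      p.1 < p.2 ∧ l p.1 = l p.2 ∧ ¬ G.Adj p.1 p.2).card +
  (Finset.univ.filter fun p : Fin n × Fin n =>
      p.1 < p.2 ∧ l p.1 ≠ l p.2 ∧ G.Adj p.1 p.2).card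

/-- The least cost of a clustering of `G` (a minimum over a nonempty set of natural numbers). -/
noncomputable def opt {n : ℕ} (G : SimpleGraph (Fin n)) : ℕ :=
  ⨅ l : Fin n → ℕ, cost G l

/-- The expectation of a `[0, ∞]`-valued function under a discrete probability distribution. -/
noncomputable def expect {α : Type*} (p : PMF α) (f : α → ℝ≥0∞) : ℝ≥0∞ :=
  ∑' a, p a * f a

/-! ### The algorithm QECC -/

/-- The variables of the algorithm: the unclustered vertices, the remaining query budget, the labels
of the clusters output so far, and the pairs queried so far. -/
structure QState (n : ℕ) where
  R : Finset (Fin n)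
  budget : ℕ
  label : Fin n → ℕ
  queries : Multiset (Sym2 (Fin n))

open Classical in
/-- The cluster `{v} ∪ (Γ⁺(v) ∩ R)`. -/
noncomputable def pivotCluster {n : ℕ} (G : SimpleGraph (Fin n)) (R : Finset (Fin n))
    (v : Fin n) : Finset (Fin n) :=
  insert v (R.filter fun w => G.Adj v w)

/-- The body of the main loop, with the pivot `v`: query all pairs `{v, w}` for `w ∈ R \ {v}`,
pay for these queries, output the cluster of `v` (labelled by `v`), and remove it from `R`. -/
noncomputable def pivotRound {n : ℕ} (G : SimpleGraph (Fin n)) (s : QState n) (v : Fin n) :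
    QState n where
  R := s.R \ pivotCluster G s.R v
  budget := s.budget - (s.R.card - 1)
  label := fun w => if w ∈ pivotCluster G s.R v then (v : ℕ) else s.label w
  queries := s.queries + (s.R.erase v).val.map fun w => s(v, w)

theorem pivotRound_card_lt {n : ℕ} (G : SimpleGraph (Fin n)) (s : QState n) {v : Fin n}
    (hv : v ∈ s.R) : (pivotRound G s v).R.card < s.R.card := by
  apply Finset.card_lt_card
  refine Finset.ssubset_iff_subset_ne.2 ⟨Finset.sdiff_subset, fun h => ?_⟩
  rw [← h] at hv
  exact (Finset.mem_sdiff.1 hv).2 (Finset.mem_insert_self _ _)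

/-- The main loop: while `R ≠ ∅` and the budget is at least `|R| - 1`, pick a pivot in `R`
uniformly at random and process it. -/
noncomputable def qeccLoop {n : ℕ} (G : SimpleGraph (Fin n)) (s : QState n) : PMF (QState n) :=
  if h : s.R.Nonempty ∧ s.R.card - 1 ≤ s.budget then
    (PMF.uniformOfFinset s.R.attach (Finset.attach_nonempty_iff.2 h.1)).bind fun v =>
      qeccLoop G (pivotRound G s v)
  else PMF.pure s
termination_by s.R.card
decreasing_by exact pivotRound_card_lt G s v.2

/-- Algorithm QECC with query budget `Q`: the joint distribution of the clustering that is output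
and of the multiset of the pairs that were queried. The vertices that are unclustered at the end of
the main loop become singletons, each labelled by itself. -/
noncomputable def qecc {n : ℕ} (G : SimpleGraph (Fin n)) (Q : ℕ) :
    PMF ((Fin n → ℕ) × Multiset (Sym2 (Fin n))) :=
  (qeccLoop G { R := Finset.univ, budget := Q, label := fun _ => 0, queries := 0 }).map fun s =>
    (fun v => if v ∈ s.R then (v : ℕ) else s.label v, s.queries)

/-! ### A randomized random access machine with query access to a graph -/

/-- The instructions. Operands are names of registers, except for the constant in `const` and the
jump targets, which are positions in the program. -/
inductive Instr where
  /-- `d := k` -/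
  | const (d k : ℕ)
  /-- `d := a` -/
  | move (d a : ℕ)
  /-- `d := a + b` -/
  | add (d a b : ℕ)
  /-- `d := a - b` (zero if `a < b`) -/
  | sub (d a b : ℕ)
  /-- `d := memory[a]` -/
  | load (d a : ℕ)
  /-- `memory[a] := b` -/
  | store (a b : ℕ)
  /-- continue at `t` -/
  | jump (t : ℕ)
  /-- if `a < b`, continue at `t` -/
  | jumpLt (a b t : ℕ)
  /-- `d :=` a uniformly random element of `{0, …, a - 1}` (zero if `a = 0`) -/
  | rand (d a : ℕ)
  /-- `d := 1` if the pair `{a, b}` is a positive edge, `d := 0` otherwise -/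
  | query (d a b : ℕ)

/-- A configuration: program counter, registers, memory, and the pairs queried so far. -/
structure Config where
  pc : ℕ
  reg : ℕ → ℕ
  mem : ℕ → ℕ
  queries : Multiset (Sym2 ℕ)

/-- Set register `d` to `x` and go to the next instruction. -/
def Config.set (c : Config) (d x : ℕ) : Config :=
  { c with pc := c.pc + 1, reg := Function.update c.reg d x }

/-- The uniform distribution on `{0, …, m - 1}`, and the point mass at zero if `m = 0`. -/
noncomputable def uniformBelow (m : ℕ) : PMF ℕ :=
  if h : m = 0 then PMF.pure 0
  else PMF.uniformOfFinset (Finset.range m) (Finset.nonempty_range_iff.2 h)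

/-- The effect of one instruction. The graph is accessible only through `oracle`. -/
noncomputable def Instr.exec (oracle : ℕ → ℕ → ℕ) (c : Config) : Instr → PMF Config
  | .const d k => PMF.pure (c.set d k)
  | .move d a => PMF.pure (c.set d (c.reg a))
  | .add d a b => PMF.pure (c.set d (c.reg a + c.reg b))
  | .sub d a b => PMF.pure (c.set d (c.reg a - c.reg b))
  | .load d a => PMF.pure (c.set d (c.mem (c.reg a)))
  | .store a b =>
      PMF.pure { c with pc := c.pc + 1, mem := Function.update c.mem (c.reg a) (c.reg b) }
  | .jump t => PMF.pure { c with pc := t }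
  | .jumpLt a b t => PMF.pure { c with pc := if c.reg a < c.reg b then t else c.pc + 1 }
  | .rand d a => (uniformBelow (c.reg a)).map fun x => c.set d x
  | .query d a b =>
      PMF.pure { c.set d (oracle (c.reg a) (c.reg b)) with
        queries := s(c.reg a, c.reg b) ::ₘ c.queries }

/-- The machine has halted when the program counter has left the program. -/
def Halted (P : List Instr) (c : Config) : Prop := P.length ≤ c.pc

/-- One step, which takes one unit of time; a halted machine does not move. -/
noncomputable def step (P : List Instr) (oracle : ℕ → ℕ → ℕ) (c : Config) : PMF Config :=
  match P[c.pc]? with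
  | some i => i.exec oracle c
  | none => PMF.pure c

/-- The distribution of the configuration after `t` steps. -/
noncomputable def run (P : List Instr) (oracle : ℕ → ℕ → ℕ) : ℕ → Config → PMF Config
  | 0, c => PMF.pure c
  | t + 1, c => (step P oracle c).bind (run P oracle t)

open Classical in
/-- Query access to the graph `G`: the answer is `1` on positive edges and `0` on all other
pairs. -/
noncomputable def edgeOracle {n : ℕ} (G : SimpleGraph (Fin n)) (u v : ℕ) : ℕ :=
  if ∃ (hu : u < n) (hv : v < n), G.Adj ⟨u, hu⟩ ⟨v, hv⟩ then 1 else 0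

/-- At the start, register `0` holds `n`, register `1` holds `Q`, and all other registers and all
memory cells hold `0`. -/
def start (n Q : ℕ) : Config where
  pc := 0
  reg := fun i => if i = 0 then n else if i = 1 then Q else 0
  mem := fun _ => 0
  queries := 0

/-- The clustering held in the memory: the vertex `v` has the label `k` if memory cell `v` holds
`k + 1`; if memory cell `v` holds the initial value `0`, then `v` has its own name as its label. -/
def Config.clustering (n : ℕ) (c : Config) : Fin n → ℕ :=
  fun v => if c.mem v = 0 then (v : ℕ) else c.mem v - 1

/-- The program `P` implements QECC in time `T n Q`: on every graph on `n` vertices and with every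
query budget `Q > 0`, all of its runs halt within `T n Q` steps, and the joint distribution of its
output clustering and of the pairs that it queries is the one of QECC. -/
def ImplementsQECC (P : List Instr) (T : ℕ → ℕ → ℕ) : Prop :=
  ∀ (n Q : ℕ), 0 < Q → ∀ G : SimpleGraph (Fin n),
    (∀ c ∈ (run P (edgeOracle G) (T n Q) (start n Q)).support, Halted P c) ∧
    (run P (edgeOracle G) (T n Q) (start n Q)).map (fun c => (c.clustering n, c.queries)) =
      (qecc G Q).map (fun r => (r.1, r.2.map (Sym2.map Fin.val)))

end CorrClust

namespace CorrClust

variable {n : ℕ}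

/-! The cost bound is a supermartingale argument (`expect_qeccLoop_le`) for a `potential` that adds
three quantities, counted over ordered pairs and therefore halved.

The first two carry the factor 3. A round with pivot `v` creates new disagreements only on pairs
forming a bad triple (two positive edges, one negative) with `v` (`settled_pivotRound_le`). Any
reference clustering `l` errs on some pair of every bad triple, and that pair leaves `R` when the
third vertex is the pivot. Averaged over the pivot, the new disagreements are thus at most three
times the disagreements of `l` that leave `R` (`sum_badAt_le`). Taking `l` optimal gives `3 * OPT`.

The third pays for the positive edges that are cut when the leftover vertices become singletons. If
`M` ordered pairs of `R` are positive, a round lowers `M` by at least `M ^ 2 / n ^ 2` on average, by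
Cauchy–Schwarz on the degrees (`sum_adjIn_le`). Hence `1 / M` grows by about `1 / n ^ 2` per round.
`decay` solves this recurrence exactly, and its concavity in `M` lets it pass through expectations
(`sum_decay_le`). A round spends fewer than `n` queries, so about `Q / n` rounds take place and at
most about `n ^ 3 / Q` ordered pairs remain.

For the running time, a program keeps the unclustered vertices in an array that it compresses in
place. Each round then takes time linear in `|R|`, which the `|R| - 1` queries of the round pay for.
`AtLoop.simulates` couples program and algorithm by induction along the main loop. -/

theorem expect_pure {α : Type*} (a : α) (f : α → ℝ≥0∞) : expect (PMF.pure a) f = f a := by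
  classical
  unfold expect
  rw [tsum_eq_single a]
  · simp
  · intro b hb
    simp [PMF.pure_apply, hb]

theorem expect_bind {α β : Type*} (p : PMF α) (g : α → PMF β) (f : β → ℝ≥0∞) :
    expect (p.bind g) f = expect p fun a => expect (g a) f := by
  simp only [expect, PMF.bind_apply, ← ENNReal.tsum_mul_right, ← ENNReal.tsum_mul_left]
  rw [ENNReal.tsum_comm]
  simp only [mul_assoc]

theorem expect_map {α β : Type*} (p : PMF α) (g : α → β) (f : β → ℝ≥0∞) :
    expect (p.map g) f = expect p (f ∘ g) := by
  rw [PMF.map, expect_bind]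
  simp [expect_pure, Function.comp_def]

theorem expect_uniformOfFinset {α : Type*} (s : Finset α) (hs : s.Nonempty) (f : α → ℝ≥0∞) :
    expect (PMF.uniformOfFinset s hs) f = (s.card : ℝ≥0∞)⁻¹ * ∑ a ∈ s, f a := by
  classical
  unfold expect
  rw [tsum_eq_sum (s := s), Finset.mul_sum]
  · refine Finset.sum_congr rfl fun a ha => ?_
    rw [PMF.uniformOfFinset_apply_of_mem hs ha]
  · intro a ha
    rw [PMF.uniformOfFinset_apply_of_notMem hs ha, zero_mul]

/-! ### Induction and potentials along the main loop -/

/-- The condition of the main loop. -/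
def QState.Continues (s : QState n) : Prop := s.R.Nonempty ∧ s.R.card - 1 ≤ s.budget

theorem qeccLoop_of_continues (G : SimpleGraph (Fin n)) {s : QState n} (h : s.Continues) :
    qeccLoop G s =
      (PMF.uniformOfFinset s.R.attach (Finset.attach_nonempty_iff.2 h.1)).bind fun v =>
        qeccLoop G (pivotRound G s v) := by
  rw [qeccLoop]
  exact dif_pos h

theorem qeccLoop_of_not_continues (G : SimpleGraph (Fin n)) {s : QState n} (h : ¬ s.Continues) :
    qeccLoop G s = PMF.pure s := by
  rw [qeccLoop]
  exact dif_neg h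

/-- Induction along the main loop. -/
theorem QState.loop_induction (G : SimpleGraph (Fin n)) {motive : QState n → Prop}
    (halt : ∀ s : QState n, ¬ s.Continues → motive s)
    (round : ∀ s : QState n, s.Continues → (∀ v ∈ s.R, motive (pivotRound G s v)) → motive s)
    (s : QState n) : motive s := by
  induction h : s.R.card using Nat.strong_induction_on generalizing s with
  | _ k ih =>
    by_cases hs : s.Continues
    · exact round s hs fun v hv => ih _ (h ▸ pivotRound_card_lt G s hv) _ rfl
    · exact halt s hs

theorem invariant_of_mem_support_qeccLoop (G : SimpleGraph (Fin n)) (I : QState n → Prop)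
    (hI : ∀ s, I s → s.Continues → ∀ v ∈ s.R, I (pivotRound G s v)) (s : QState n) :
    I s → ∀ a ∈ (qeccLoop G s).support, I a := by
  induction s using QState.loop_induction G with
  | halt s h =>
    intro hs a ha
    rw [qeccLoop_of_not_continues G h] at ha
    rw [PMF.support_pure, Set.mem_singleton_iff] at ha
    exact ha ▸ hs
  | round s h ih =>
    intro hs a ha
    rw [qeccLoop_of_continues G h, PMF.mem_support_bind_iff] at ha
    obtain ⟨v, -, hv⟩ := ha
    exact ih v v.2 (hI s hs h v v.2) a hv

/-- A potential that does not increase on average in a round bounds the expectation at the end of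
the main loop. -/
theorem expect_qeccLoop_le (G : SimpleGraph (Fin n)) (I : QState n → Prop)
    (Ψ f : QState n → ℝ≥0∞)
    (hI : ∀ s, I s → s.Continues → ∀ v ∈ s.R, I (pivotRound G s v))
    (hΨ : ∀ s, I s → s.Continues → ∑ v ∈ s.R, Ψ (pivotRound G s v) ≤ s.R.card * Ψ s)
    (hf : ∀ s, I s → ¬ s.Continues → f s ≤ Ψ s) (s : QState n) :
    I s → expect (qeccLoop G s) f ≤ Ψ s := by
  induction s using QState.loop_induction G with
  | halt s h =>
    intro hs
    rw [qeccLoop_of_not_continues G h, expect_pure]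
    exact hf s hs h
  | round s h ih =>
    intro hs
    rw [qeccLoop_of_continues G h, expect_bind, expect_uniformOfFinset, Finset.card_attach,
      ← ENNReal.div_eq_inv_mul]
    refine ENNReal.div_le_of_le_mul' ?_
    refine le_trans ?_ (hΨ s hs h)
    rw [← Finset.sum_attach s.R]
    exact Finset.sum_le_sum fun v _ => ih v v.2 (hI s hs h v v.2)

/-- Queries made plus remaining budget is invariant: the loop condition ensures that the truncated
subtraction in the budget is exact. -/
theorem card_queries_le (G : SimpleGraph (Fin n)) (Q : ℕ)
    (r : (Fin n → ℕ) × Multiset (Sym2 (Fin n))) (hr : r ∈ (qecc G Q).support) :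
    Multiset.card r.2 ≤ Q := by
  rw [qecc, PMF.support_map] at hr
  obtain ⟨s, hs, rfl⟩ := hr
  have := invariant_of_mem_support_qeccLoop G
    (fun s => Multiset.card s.queries + s.budget = Q) ?_ _ (by simp) s hs
  · exact this ▸ Nat.le_add_right _ _
  · intro s hs hc v hv
    have h2 := hc.2
    simp only [pivotRound, Multiset.card_add, Multiset.card_map, Finset.card_val,
      Finset.card_erase_of_mem hv]
    omega

theorem mem_pivotCluster {G : SimpleGraph (Fin n)} {R : Finset (Fin n)} {v w : Fin n} :
    w ∈ pivotCluster G R v ↔ w = v ∨ w ∈ R ∧ G.Adj v w := by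
  simp [pivotCluster]

/-! ### Disagreements as ordered pairs -/

/-- The clustering `l` disagrees with `G` on the pair `u`, `w`. -/
def Disagree (G : SimpleGraph (Fin n)) (l : Fin n → ℕ) (u w : Fin n) : Prop :=
  u ≠ w ∧ (l u = l w ↔ ¬ G.Adj u w)

theorem Disagree.symm {G : SimpleGraph (Fin n)} {l : Fin n → ℕ} {u w : Fin n}
    (h : Disagree G l u w) : Disagree G l w u :=
  ⟨h.1.symm, by rw [eq_comm, G.adj_comm]; exact h.2⟩

open Classical in
theorem card_filter_ne_eq_two_mul (r : Fin n → Fin n → Prop) (hr : ∀ u w, r u w → r w u)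
    (hne : ∀ u w, r u w → u ≠ w) :
    (Finset.univ.filter fun p : Fin n × Fin n => r p.1 p.2).card =
      2 * (Finset.univ.filter fun p : Fin n × Fin n => p.1 < p.2 ∧ r p.1 p.2).card := by
  have h1 : (Finset.univ.filter fun p : Fin n × Fin n => p.2 < p.1 ∧ r p.1 p.2).card =
      (Finset.univ.filter fun p : Fin n × Fin n => p.1 < p.2 ∧ r p.1 p.2).card := by
    refine Finset.card_bij' (fun p _ => p.swap) (fun p _ => p.swap) ?_ ?_ ?_ ?_ <;>
      simp +contextual [hr]
  rw [two_mul]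
  nth_rewrite 1 [← h1]
  rw [← Finset.card_union_of_disjoint]
  · congr 1
    ext p
    simp only [Finset.mem_filter, Finset.mem_univ, true_and, Finset.mem_union]
    refine ⟨fun h => ?_, fun h => h.elim And.right And.right⟩
    rcases lt_or_gt_of_ne (hne _ _ h) with h' | h'
    · exact Or.inr ⟨h', h⟩
    · exact Or.inl ⟨h', h⟩
  · rw [Finset.disjoint_filter]
    exact fun p _ h h' => lt_asymm h.1 h'.1

-- Ordered pairs make the later counts sums over `R ×ˢ R`, in which the variables can be permuted
-- freely.
open Classical in
theorem two_mul_cost (G : SimpleGraph (Fin n)) (l : Fin n → ℕ) :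
    2 * cost G l = (Finset.univ.filter fun p : Fin n × Fin n => Disagree G l p.1 p.2).card := by
  rw [card_filter_ne_eq_two_mul _ (fun _ _ h => h.symm) (fun _ _ h => h.1), cost,
    ← Finset.card_union_of_disjoint]
  · congr 2
    ext p
    simp only [Finset.mem_filter, Finset.mem_univ, true_and, Finset.mem_union]
    simp only [Disagree]
    constructor
    · rintro (⟨h, h', h''⟩ | ⟨h, h', h''⟩)
      · exact ⟨h, h.ne, by simp [h', h'']⟩
      · exact ⟨h, h.ne, by simp [h', h'']⟩
    · rintro ⟨h, -, h'⟩
      by_cases hG : G.Adj p.1 p.2 <;> simp_all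
  · rw [Finset.disjoint_filter]
    exact fun p _ h h' => h'.2.1 h.2.1

open Classical in
/-- The number of ordered pairs in `R` on which `l` disagrees with `G`. -/
noncomputable def disagreeIn (G : SimpleGraph (Fin n)) (l : Fin n → ℕ) (R : Finset (Fin n)) : ℕ :=
  ((R ×ˢ R).filter fun p => Disagree G l p.1 p.2).card

open Classical in
/-- The number of ordered pairs in `R` that are positive edges. -/
noncomputable def adjIn (G : SimpleGraph (Fin n)) (R : Finset (Fin n)) : ℕ :=
  ((R ×ˢ R).filter fun p => G.Adj p.1 p.2).card

/-- The clustering that results if the remaining vertices become singletons. -/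
def QState.output (s : QState n) : Fin n → ℕ := fun v => if v ∈ s.R then (v : ℕ) else s.label v

open Classical in
/-- The number of ordered pairs not contained in the remaining vertices on which the output
disagrees with `G`. -/
noncomputable def QState.settled (G : SimpleGraph (Fin n)) (s : QState n) : ℕ :=
  (Finset.univ.filter fun p : Fin n × Fin n =>
    Disagree G s.output p.1 p.2 ∧ ¬ (p.1 ∈ s.R ∧ p.2 ∈ s.R)).card

/-! ### Charging disagreements to bad triples -/

/-- The vertices `v`, `u`, `w` are distinct and form exactly two positive edges. -/
def BadTriple (G : SimpleGraph (Fin n)) (v u w : Fin n) : Prop :=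
  u ≠ w ∧ v ≠ u ∧ v ≠ w ∧
    (G.Adj v u ∧ G.Adj v w ∧ ¬ G.Adj u w ∨ G.Adj v u ∧ ¬ G.Adj v w ∧ G.Adj u w ∨
      ¬ G.Adj v u ∧ G.Adj v w ∧ G.Adj u w)

theorem BadTriple.rotate {G : SimpleGraph (Fin n)} {v u w : Fin n} (h : BadTriple G v u w) :
    BadTriple G u w v := by
  obtain ⟨h1, h2, h3, h⟩ := h
  refine ⟨h3.symm, h1, h2.symm, ?_⟩
  rw [G.adj_comm w v, G.adj_comm u v]
  tauto

open Classical in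
/-- The number of ordered pairs in `R` that form a bad triple with `v`. -/
noncomputable def badAt (G : SimpleGraph (Fin n)) (R : Finset (Fin n)) (v : Fin n) : ℕ :=
  ((R ×ˢ R).filter fun p => BadTriple G v p.1 p.2).card

/-- Clustered vertices are labelled by clustered vertices. -/
def QState.LabelsSettled (s : QState n) : Prop :=
  ∀ u ∉ s.R, ∃ x ∉ s.R, s.label u = (x : Fin n)

theorem QState.LabelsSettled.pivotRound (G : SimpleGraph (Fin n)) {s : QState n}
    (hs : s.LabelsSettled) (v : Fin n) : (pivotRound G s v).LabelsSettled := by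
  intro u hu
  by_cases h : u ∈ pivotCluster G s.R v
  · exact ⟨v, by simp [CorrClust.pivotRound, mem_pivotCluster],
      by simp [CorrClust.pivotRound, h]⟩
  · have hu' : u ∉ s.R := fun h' => hu (by simp [CorrClust.pivotRound, h', h])
    obtain ⟨x, hx, hl⟩ := hs u hu'
    exact ⟨x, fun h' => hx (by simpa [CorrClust.pivotRound] using
      (Finset.mem_sdiff.1 h').1), by simp [CorrClust.pivotRound, h, hl]⟩

/-- Remaining vertices get distinct labels, so a pair inside `R` is a disagreement only if it is a
positive edge. -/
theorem two_mul_cost_output_le (G : SimpleGraph (Fin n)) (s : QState n) :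
    2 * cost G s.output ≤ s.settled G + adjIn G s.R := by
  classical
  rw [two_mul_cost, QState.settled, adjIn]
  refine le_trans (Finset.card_le_card ?_) (Finset.card_union_le _ _)
  intro p hp
  simp only [Finset.mem_filter, Finset.mem_univ, true_and, Finset.mem_union,
    Finset.mem_product] at hp ⊢
  by_cases h : p.1 ∈ s.R ∧ p.2 ∈ s.R
  · refine Or.inr ⟨h, ?_⟩
    have h2 := hp.2
    have h1 := hp.1
    simp only [QState.output, h.1, h.2, if_true, Fin.val_inj, h1, false_iff, not_not] at h2
    exact h2
  · exact Or.inl ⟨hp, h⟩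

/-- A pair settled by this round lies in `R` and meets the cluster of `v`. Pairs containing `v` are
labelled correctly. For the others, a disagreement is either a negative edge between two neighbours
of `v` or a positive edge from a neighbour to a non-neighbour; both are bad triples. -/
theorem settled_pivotRound_le (G : SimpleGraph (Fin n)) {s : QState n} (hs : s.LabelsSettled)
    {v : Fin n} (hv : v ∈ s.R) :
    (pivotRound G s v).settled G ≤ s.settled G + badAt G s.R v := by
  classical
  rw [QState.settled, QState.settled, badAt]
  refine le_trans (Finset.card_le_card ?_) (Finset.card_union_le _ _)
  have out_of_notMem : ∀ u ∉ s.R, (pivotRound G s v).output u = s.output u ∧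
      ∃ x ∉ s.R, s.output u = (x : Fin n) := by
    intro u hu
    have h1 : u ∉ pivotCluster G s.R v := by
      rw [mem_pivotCluster]
      rintro (rfl | h)
      · exact hu hv
      · exact hu h.1
    refine ⟨by simp [QState.output, pivotRound, hu, h1], ?_⟩
    obtain ⟨x, hx, h⟩ := hs u hu
    exact ⟨x, hx, by simp [QState.output, hu, h]⟩
  have out_of_mem : ∀ u ∈ s.R, (pivotRound G s v).output u =
      if u ∈ pivotCluster G s.R v then (v : ℕ) else u := by
    intro u hu
    by_cases h : u ∈ pivotCluster G s.R v <;> simp [QState.output, pivotRound, hu, h]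
  have out_mem : ∀ u ∈ s.R, (∃ x ∈ s.R, (pivotRound G s v).output u = (x : Fin n)) ∧
      s.output u = u := by
    intro u hu
    refine ⟨?_, by simp [QState.output, hu]⟩
    rw [out_of_mem u hu]
    split_ifs
    · exact ⟨v, hv, rfl⟩
    · exact ⟨u, hu, rfl⟩
  -- Labels of clustered vertices name vertices outside `R`, labels of vertices in `R` name vertices
  -- in `R`, both before and after the round. So such pairs are separated throughout and their
  -- status does not change.
  have cross : ∀ u ∉ s.R, ∀ w ∈ s.R, (pivotRound G s v).output u ≠ (pivotRound G s v).output w ∧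
      s.output u ≠ s.output w := by
    intro u hu w hw
    obtain ⟨h1, x, hx, h2⟩ := out_of_notMem u hu
    obtain ⟨⟨y, hy, h3⟩, h4⟩ := out_mem w hw
    rw [h1, h2, h3, h4, Ne, Ne, Fin.val_inj, Fin.val_inj]
    exact ⟨fun h => hx (h ▸ hy), fun h => hx (h ▸ hw)⟩
  rintro ⟨u, w⟩ hp
  simp only [Finset.mem_filter, Finset.mem_univ, true_and, Finset.mem_union,
    Finset.mem_product] at hp ⊢
  obtain ⟨⟨hne, hd⟩, hR⟩ := hp
  by_cases hu : u ∈ s.R <;> by_cases hw : w ∈ s.R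
  · refine Or.inr ⟨⟨hu, hw⟩, ?_⟩
    rw [out_of_mem u hu, out_of_mem w hw] at hd
    have hRu : u ∈ (pivotRound G s v).R ↔ u ∉ pivotCluster G s.R v := by simp [pivotRound, hu]
    have hRw : w ∈ (pivotRound G s v).R ↔ w ∉ pivotCluster G s.R v := by simp [pivotRound, hw]
    rw [hRu, hRw] at hR
    have e1 : u ∈ pivotCluster G s.R v ↔ u = v ∨ G.Adj v u := by simp [mem_pivotCluster, hu]
    have e2 : w ∈ pivotCluster G s.R v ↔ w = v ∨ G.Adj v w := by simp [mem_pivotCluster, hw]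
    by_cases c1 : u ∈ pivotCluster G s.R v <;> by_cases c2 : w ∈ pivotCluster G s.R v
    · simp only [c1, c2, if_true, true_iff] at hd
      rcases e1.1 c1 with rfl | h1
      · rcases e2.1 c2 with h2 | h2
        · exact absurd h2.symm hne
        · exact absurd h2 hd
      · rcases e2.1 c2 with rfl | h2
        · exact absurd h1.symm hd
        · exact ⟨hne, h1.ne, h2.ne, Or.inl ⟨h1, h2, hd⟩⟩
    · have c2' := mt e2.2 c2
      push Not at c2'
      simp only [c1, c2, if_true, if_false, Fin.val_inj, c2'.1.symm, false_iff, not_not] at hd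
      rcases e1.1 c1 with rfl | h1
      · exact absurd hd c2'.2
      · exact ⟨hne, h1.ne, c2'.1.symm, Or.inr (Or.inl ⟨h1, c2'.2, hd⟩)⟩
    · have c1' := mt e1.2 c1
      push Not at c1'
      simp only [c1, c2, if_true, if_false, Fin.val_inj, c1'.1, false_iff, not_not] at hd
      rcases e2.1 c2 with rfl | h2
      · exact absurd hd.symm c1'.2
      · exact ⟨hne, c1'.1.symm, h2.ne, Or.inr (Or.inr ⟨c1'.2, h2, hd⟩)⟩
    · exact absurd ⟨c1, c2⟩ hR
  · refine Or.inl ⟨⟨hne, ?_⟩, by tauto⟩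
    have := cross w hw u hu
    rw [← hd]
    exact iff_of_false this.2.symm this.1.symm
  · refine Or.inl ⟨⟨hne, ?_⟩, by tauto⟩
    have := cross u hu w hw
    rw [← hd]
    exact iff_of_false this.2 this.1
  · refine Or.inl ⟨⟨hne, ?_⟩, by tauto⟩
    rw [← hd, (out_of_notMem u hu).1, (out_of_notMem w hw).1]

theorem pivotCluster_subset {G : SimpleGraph (Fin n)} {R : Finset (Fin n)} {v : Fin n}
    (hv : v ∈ R) : pivotCluster G R v ⊆ R := by
  intro w hw
  rcases mem_pivotCluster.1 hw with rfl | h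
  · exact hv
  · exact h.1

/-- Agreement on all three pairs would put the ends of the negative edge in the same cluster through
the third vertex. -/
theorem BadTriple.exists_disagree {G : SimpleGraph (Fin n)} {v u w : Fin n}
    (h : BadTriple G v u w) (l : Fin n → ℕ) :
    Disagree G l u w ∨ Disagree G l w v ∨ Disagree G l v u := by
  obtain ⟨h1, h2, h3, h⟩ := h
  simp only [Disagree, G.adj_comm w v, h1, h2, h3.symm, ne_eq, not_false_eq_true, true_and]
  by_contra! hc
  grind

open Classical in
theorem disagreeIn_eq_add (G : SimpleGraph (Fin n)) (l : Fin n → ℕ) (R C : Finset (Fin n)) :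
    disagreeIn G l R = disagreeIn G l (R \ C) +
      ((R ×ˢ R).filter fun p => Disagree G l p.1 p.2 ∧ (p.1 ∈ C ∨ p.2 ∈ C)).card := by
  rw [disagreeIn, disagreeIn, ← Finset.card_union_of_disjoint]
  · congr 1
    ext p
    simp only [Finset.mem_filter, Finset.mem_union, Finset.mem_product, Finset.mem_sdiff]
    tauto
  · rw [Finset.disjoint_left]
    intro p
    simp only [Finset.mem_filter, Finset.mem_product, Finset.mem_sdiff]
    tauto

/-- Each bad triple is charged to a pair on which `l` errs, seen from the opposite vertex as pivot.
Rotating the triple turns the three possible positions of that pair into the factor 3. -/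
theorem sum_badAt_le (G : SimpleGraph (Fin n)) (l : Fin n → ℕ) (R : Finset (Fin n)) :
    ∑ v ∈ R, badAt G R v + 3 * ∑ v ∈ R, disagreeIn G l (R \ pivotCluster G R v) ≤
      3 * (R.card * disagreeIn G l R) := by
  classical
  let b : Fin n → Fin n → Fin n → ℕ := fun v u w =>
    if BadTriple G v u w ∧ Disagree G l u w then 1 else 0
  have h1 : ∑ v ∈ R, badAt G R v ≤
      ∑ v ∈ R, ∑ u ∈ R, ∑ w ∈ R, (b v u w + b u w v + b w v u) := by
    refine Finset.sum_le_sum fun v _ => ?_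
    rw [badAt, Finset.card_filter, Finset.sum_product]
    refine Finset.sum_le_sum fun u _ => Finset.sum_le_sum fun w _ => ?_
    split_ifs with h
    · have h' : BadTriple G v u w := h
      have := h'.exists_disagree l
      simp only [b, h', h'.rotate, h'.rotate.rotate, true_and]
      split_ifs <;> simp_all
    · exact Nat.zero_le _
  have h2 : ∑ v ∈ R, ∑ u ∈ R, ∑ w ∈ R, (b v u w + b u w v + b w v u) =
      3 * ∑ v ∈ R, ∑ u ∈ R, ∑ w ∈ R, b v u w := by
    simp only [Finset.sum_add_distrib]
    have e1 : ∑ v ∈ R, ∑ u ∈ R, ∑ w ∈ R, b u w v = ∑ v ∈ R, ∑ u ∈ R, ∑ w ∈ R, b v u w := by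
      rw [Finset.sum_comm]
      exact Finset.sum_congr rfl fun _ _ => Finset.sum_comm
    have e2 : ∑ v ∈ R, ∑ u ∈ R, ∑ w ∈ R, b w v u = ∑ v ∈ R, ∑ u ∈ R, ∑ w ∈ R, b v u w := by
      calc _ = ∑ v ∈ R, ∑ w ∈ R, ∑ u ∈ R, b w v u :=
            Finset.sum_congr rfl fun _ _ => Finset.sum_comm
        _ = _ := Finset.sum_comm
    rw [e1, e2]
    ring
  have h3 : ∑ v ∈ R, ∑ u ∈ R, ∑ w ∈ R, b v u w ≤ ∑ v ∈ R, ((R ×ˢ R).filter fun p =>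
      Disagree G l p.1 p.2 ∧
        (p.1 ∈ pivotCluster G R v ∨ p.2 ∈ pivotCluster G R v)).card := by
    refine Finset.sum_le_sum fun v _ => ?_
    rw [Finset.card_filter, Finset.sum_product]
    refine Finset.sum_le_sum fun u hu => Finset.sum_le_sum fun w hw => ?_
    simp only [b]
    split_ifs with h h'
    · exact le_rfl
    -- Every vertex of a bad triple has a positive edge to one of the other two, so the pivot
    -- removes at least one end of the pair.
    · refine absurd ⟨h.2, ?_⟩ h'
      rw [mem_pivotCluster, mem_pivotCluster]
      have := h.1.2.2.2
      tauto
    · exact Nat.zero_le _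
    · exact le_rfl
  have h4 : R.card * disagreeIn G l R = ∑ v ∈ R, disagreeIn G l R := by simp
  rw [h4, Finset.sum_congr rfl fun v _ => disagreeIn_eq_add G l R (pivotCluster G R v),
    Finset.sum_add_distrib, mul_add]
  omega

/-- Removing the cluster of `v` destroys at least as many ordered positive pairs as the sum of the
degrees of the neighbours of `v`. Summed over `v` this is the sum of the squared degrees, which
Cauchy–Schwarz bounds below. -/
theorem sum_adjIn_le (G : SimpleGraph (Fin n)) (R : Finset (Fin n)) :
    R.card * ∑ v ∈ R, adjIn G (R \ pivotCluster G R v) + adjIn G R ^ 2 ≤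
      R.card ^ 2 * adjIn G R := by
  classical
  let d : Fin n → ℕ := fun u => ∑ w ∈ R, if G.Adj u w then 1 else 0
  have hd : adjIn G R = ∑ u ∈ R, d u := by
    rw [adjIn, Finset.card_filter, Finset.sum_product]
  have h1 : ∀ v ∈ R, adjIn G (R \ pivotCluster G R v) +
      ∑ u ∈ R, (if G.Adj u v then 1 else 0) * d u ≤ adjIn G R := by
    intro v hv
    have e1 : adjIn G (R \ pivotCluster G R v) ≤ ∑ u ∈ R \ pivotCluster G R v, d u := by
      rw [adjIn, Finset.card_filter, Finset.sum_product]
      exact Finset.sum_le_sum fun u _ => Finset.sum_le_sum_of_subset Finset.sdiff_subset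
    have e2 : ∑ u ∈ R, (if G.Adj u v then 1 else 0) * d u ≤ ∑ u ∈ pivotCluster G R v, d u := by
      simp only [ite_mul, one_mul, zero_mul]
      rw [← Finset.sum_filter]
      refine Finset.sum_le_sum_of_subset fun u hu => ?_
      rw [Finset.mem_filter] at hu
      exact mem_pivotCluster.2 (Or.inr ⟨hu.1, hu.2.symm⟩)
    rw [hd, ← Finset.sum_sdiff (f := d) (pivotCluster_subset (G := G) hv)]
    exact add_le_add e1 e2
  have h2 : ∑ v ∈ R, ∑ u ∈ R, (if G.Adj u v then 1 else 0) * d u = ∑ u ∈ R, d u ^ 2 := by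
    rw [Finset.sum_comm]
    refine Finset.sum_congr rfl fun u _ => ?_
    rw [← Finset.sum_mul, sq]
  have h3 := Finset.sum_le_sum h1
  rw [Finset.sum_add_distrib, h2, Finset.sum_const, smul_eq_mul] at h3
  have h4 : adjIn G R ^ 2 ≤ R.card * ∑ u ∈ R, d u ^ 2 := by
    rw [hd]
    exact sq_sum_le_card_mul_sum_sq
  nlinarith [Nat.mul_le_mul_left R.card h3]

theorem adjIn_le (G : SimpleGraph (Fin n)) (R : Finset (Fin n)) : adjIn G R ≤ R.card ^ 2 := by
  classical
  rw [adjIn, sq, ← Finset.card_product]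
  exact Finset.card_filter_le _ _

/-! ### The potential -/

/-- The solution of the recurrence `x ↦ N * x / (N + x)` after `k` steps from `M`. -/
noncomputable def decay (N M k : ℝ) : ℝ := N * M / (N + k * M)

theorem decay_nonneg {N M k : ℝ} (hN : 0 ≤ N) (hM : 0 ≤ M) (hk : 0 ≤ k) : 0 ≤ decay N M k := by
  unfold decay
  positivity

theorem decay_anti {N M k k' : ℝ} (hN : 0 < N) (hM : 0 ≤ M) (hk : 0 ≤ k) (h : k ≤ k') :
    decay N M k' ≤ decay N M k := by
  unfold decay
  gcongr

/-- Concavity of `decay` in its second argument: the gap to the tangent at `x` is an explicit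
nonnegative multiple of `(y - x) ^ 2`. -/
theorem decay_le_tangent {N k x y : ℝ} (hN : 0 < N) (hk : 0 ≤ k) (hx : 0 ≤ x) (hy : 0 ≤ y) :
    decay N y k ≤ decay N x k + N ^ 2 / (N + k * x) ^ 2 * (y - x) := by
  unfold decay
  have h1 : 0 < N + k * x := by positivity
  have h2 : 0 < N + k * y := by positivity
  have : N * x / (N + k * x) + N ^ 2 / (N + k * x) ^ 2 * (y - x) - N * y / (N + k * y) =
      N ^ 2 * k * (y - x) ^ 2 / ((N + k * x) ^ 2 * (N + k * y)) := by
    field_simp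
    ring
  have h3 : 0 ≤ N ^ 2 * k * (y - x) ^ 2 / ((N + k * x) ^ 2 * (N + k * y)) := by positivity
  linarith

/-- Jensen's inequality, with the tangent taken at `decay N M 1`. Its slope is nonnegative, so an
upper bound for the mean of `y` suffices, and `M - M ^ 2 / N` is at most `decay N M 1`. -/
theorem sum_decay_le {ι : Type*} (s : Finset ι) (y : ι → ℝ) {N M k : ℝ} (hN : 0 < N)
    (hM : 0 ≤ M) (hk : 0 ≤ k) (hy : ∀ i ∈ s, 0 ≤ y i)
    (hs : ∑ i ∈ s, y i ≤ s.card * (M - M ^ 2 / N)) :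
    ∑ i ∈ s, decay N (y i) k ≤ s.card * decay N M (k + 1) := by
  have hx : 0 ≤ decay N M 1 := decay_nonneg hN.le hM zero_le_one
  -- For `M > 0`, the reciprocal of `decay N M k` is `1 / M + k / N`, so steps compose additively in
  -- `k`.
  have h1 : decay N (decay N M 1) k = decay N M (k + 1) := by
    unfold decay
    have : 0 < N + M := by positivity
    have : 0 < N + k * M + M := by positivity
    rw [one_mul]
    field_simp
    ring
  have h2 : M - M ^ 2 / N ≤ decay N M 1 := by
    unfold decay
    rw [one_mul, le_div_iff₀ (by positivity)]
    have : (M - M ^ 2 / N) * (N + M) = N * M - M ^ 3 / N := by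
      field_simp
      ring
    have : 0 ≤ M ^ 3 / N := by positivity
    linarith
  calc ∑ i ∈ s, decay N (y i) k
      ≤ ∑ i ∈ s, (decay N (decay N M 1) k +
          N ^ 2 / (N + k * decay N M 1) ^ 2 * (y i - decay N M 1)) :=
        Finset.sum_le_sum fun i hi => decay_le_tangent hN hk hx (hy i hi)
    _ = s.card * decay N M (k + 1) +
          N ^ 2 / (N + k * decay N M 1) ^ 2 * (∑ i ∈ s, y i - s.card * decay N M 1) := by
        rw [Finset.sum_add_distrib, ← Finset.mul_sum, Finset.sum_sub_distrib, h1]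
        simp
    _ ≤ s.card * decay N M (k + 1) := by
        have h3 : ∑ i ∈ s, y i - s.card * decay N M 1 ≤ 0 := by
          have : (s.card : ℝ) * (M - M ^ 2 / N) ≤ s.card * decay N M 1 := by gcongr
          linarith
        have := mul_nonpos_of_nonneg_of_nonpos
          (show 0 ≤ N ^ 2 / (N + k * decay N M 1) ^ 2 by positivity) h3
        linarith

/-- A lower bound for the number of rounds that the budget still allows. -/
noncomputable def QState.roundsLeft (s : QState n) : ℝ := max 0 ((s.budget : ℝ) / n - 1)

theorem roundsLeft_le (G : SimpleGraph (Fin n)) {s : QState n} (hc : s.Continues)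
    (v : Fin n) : s.roundsLeft ≤ (pivotRound G s v).roundsLeft + 1 := by
  have hn : (0 : ℝ) < n := by
    exact_mod_cast v.pos
  have hR : s.R.card ≤ n := by simpa using Finset.card_le_univ s.R
  have h2 := hc.2
  have hb : (s.budget : ℝ) ≤ (pivotRound G s v).budget + n := by
    have : s.budget ≤ (pivotRound G s v).budget + n := by
      simp only [pivotRound]
      omega
    exact_mod_cast this
  have : (s.budget : ℝ) / n ≤ (pivotRound G s v).budget / n + 1 := by
    rw [div_add_one hn.ne']
    gcongr
  simp only [QState.roundsLeft]
  refine max_le ?_ ?_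
  · linarith [le_max_left 0 (((pivotRound G s v).budget : ℝ) / n - 1)]
  · linarith [le_max_right 0 (((pivotRound G s v).budget : ℝ) / n - 1)]

/-- Half the sum of the disagreements settled so far, three times the disagreements of the
reference clustering `l` that are left, and a bound for the positive edges that are expected to be
left when the budget is exhausted. -/
noncomputable def potential (G : SimpleGraph (Fin n)) (l : Fin n → ℕ) (s : QState n) : ℝ :=
  (s.settled G + 3 * disagreeIn G l s.R + decay ((n : ℝ) ^ 2) (adjIn G s.R) s.roundsLeft) / 2

theorem roundsLeft_nonneg (s : QState n) : 0 ≤ s.roundsLeft := le_max_left _ _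

theorem potential_nonneg (G : SimpleGraph (Fin n)) (l : Fin n → ℕ) (s : QState n) :
    0 ≤ potential G l s := by
  have := decay_nonneg (sq_nonneg (n : ℝ)) (Nat.cast_nonneg (adjIn G s.R)) (roundsLeft_nonneg s)
  unfold potential
  positivity

theorem sum_decay_pivotRound_le (G : SimpleGraph (Fin n)) {s : QState n} (hc : s.Continues) :
    ∑ v ∈ s.R, decay ((n : ℝ) ^ 2) (adjIn G (pivotRound G s v).R) (pivotRound G s v).roundsLeft ≤
      s.R.card * decay ((n : ℝ) ^ 2) (adjIn G s.R) s.roundsLeft := by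
  obtain ⟨v₀, hv₀⟩ := hc.1
  have hn : (0 : ℝ) < n := by exact_mod_cast v₀.pos
  have hr : (0 : ℝ) < s.R.card := by exact_mod_cast Finset.card_pos.2 hc.1
  have hrn : (s.R.card : ℝ) ≤ n := by
    exact_mod_cast (by simpa using Finset.card_le_univ s.R : s.R.card ≤ n)
  have hk := roundsLeft_nonneg (pivotRound G s v₀)
  -- The budget left after a round does not depend on the pivot, so a single `k` serves for the
  -- whole sum.
  have h : ∀ v, (pivotRound G s v).roundsLeft = (pivotRound G s v₀).roundsLeft := fun _ => rfl
  have hsum : (∑ v ∈ s.R, (adjIn G (pivotRound G s v).R : ℝ)) ≤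
      s.R.card * (adjIn G s.R - (adjIn G s.R : ℝ) ^ 2 / (n : ℝ) ^ 2) := by
    have h1 : (s.R.card : ℝ) * ∑ v ∈ s.R, (adjIn G (pivotRound G s v).R : ℝ) +
        (adjIn G s.R : ℝ) ^ 2 ≤ (s.R.card : ℝ) ^ 2 * adjIn G s.R := by
      exact_mod_cast sum_adjIn_le G s.R
    have h2 : (adjIn G s.R : ℝ) ^ 2 / (n : ℝ) ^ 2 ≤
        (adjIn G s.R : ℝ) ^ 2 / (s.R.card : ℝ) ^ 2 := by gcongr
    have h3 : (s.R.card : ℝ) ^ 2 * ((adjIn G s.R : ℝ) ^ 2 / (s.R.card : ℝ) ^ 2) =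
        (adjIn G s.R : ℝ) ^ 2 := by field_simp
    have h4 := mul_le_mul_of_nonneg_left h2 (sq_nonneg (s.R.card : ℝ))
    refine le_of_mul_le_mul_left ?_ hr
    nlinarith
  calc _ ≤ s.R.card * decay ((n : ℝ) ^ 2) (adjIn G s.R)
            ((pivotRound G s v₀).roundsLeft + 1) := by
        simp only [h]
        exact sum_decay_le s.R _ (by positivity) (Nat.cast_nonneg _) hk
          (fun _ _ => Nat.cast_nonneg _) hsum
    _ ≤ _ := by
        gcongr
        exact decay_anti (by positivity) (Nat.cast_nonneg _) (roundsLeft_nonneg s)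
          (roundsLeft_le G hc v₀)

theorem sum_potential_le (G : SimpleGraph (Fin n)) (l : Fin n → ℕ) {s : QState n}
    (hs : s.LabelsSettled) (hc : s.Continues) :
    ∑ v ∈ s.R, potential G l (pivotRound G s v) ≤ s.R.card * potential G l s := by
  have h1 : ∑ v ∈ s.R, ((pivotRound G s v).settled G : ℝ) ≤
      s.R.card * s.settled G + ∑ v ∈ s.R, (badAt G s.R v : ℝ) := by
    have := Finset.sum_le_sum fun v (hv : v ∈ s.R) => settled_pivotRound_le G hs hv
    rw [Finset.sum_add_distrib, Finset.sum_const, smul_eq_mul] at this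
    exact_mod_cast this
  have h2 : ∑ v ∈ s.R, (badAt G s.R v : ℝ) +
      3 * ∑ v ∈ s.R, (disagreeIn G l (pivotRound G s v).R : ℝ) ≤
        3 * (s.R.card * disagreeIn G l s.R) := by
    exact_mod_cast sum_badAt_le G l s.R
  have h3 := sum_decay_pivotRound_le G hc
  simp only [potential]
  rw [← Finset.sum_div, Finset.sum_add_distrib, Finset.sum_add_distrib, ← Finset.mul_sum]
  linarith

/-- If vertices remain, the budget is below `|R| - 1`, hence below `n`. Then `roundsLeft` is zero
and `decay` equals `adjIn`; the shift by one in `roundsLeft` is made for this. -/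
theorem cost_output_le_potential (G : SimpleGraph (Fin n)) (l : Fin n → ℕ) {s : QState n}
    (hc : ¬ s.Continues) : (cost G s.output : ℝ) ≤ potential G l s := by
  have h1 : (2 : ℝ) * cost G s.output ≤ s.settled G + adjIn G s.R := by
    exact_mod_cast two_mul_cost_output_le G s
  have h2 : (adjIn G s.R : ℝ) ≤ decay ((n : ℝ) ^ 2) (adjIn G s.R) s.roundsLeft := by
    rcases s.R.eq_empty_or_nonempty with h | h
    · have : adjIn G s.R = 0 := by
        have := adjIn_le G s.R
        simp only [h, Finset.card_empty] at this ⊢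
        omega
      rw [this, Nat.cast_zero]
      exact decay_nonneg (sq_nonneg _) le_rfl (roundsLeft_nonneg s)
    · obtain ⟨v, hv⟩ := id h
      have hn : (0 : ℝ) < n := by exact_mod_cast v.pos
      have hR : s.R.card ≤ n := by simpa using Finset.card_le_univ s.R
      have hb : (s.budget : ℝ) ≤ n := by
        have : ¬ (s.R.card - 1 ≤ s.budget) := fun h' => hc ⟨h, h'⟩
        exact_mod_cast (by omega : s.budget ≤ n)
      have hk : s.roundsLeft = 0 := by
        refine max_eq_left ?_
        rw [sub_nonpos, div_le_one hn]
        exact hb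
      rw [hk, decay]
      field_simp
      simp
  have h3 : (0 : ℝ) ≤ disagreeIn G l s.R := Nat.cast_nonneg _
  unfold potential
  linarith

/-- Here `Q ≤ n * (k + 1)` for `k` the initial `roundsLeft`, and at most `n ^ 2` ordered pairs are
positive; together these bound the `decay` term by `n ^ 3 / Q`. -/
theorem potential_initial_le (G : SimpleGraph (Fin n)) (l : Fin n → ℕ) {Q : ℕ} (hQ : 0 < Q)
    (label : Fin n → ℕ) (queries : Multiset (Sym2 (Fin n))) :
    potential G l { R := Finset.univ, budget := Q, label := label, queries := queries } ≤
      3 * cost G l + (n : ℝ) ^ 3 / (2 * Q) := by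
  classical
  set s : QState n := { R := Finset.univ, budget := Q, label := label, queries := queries }
    with hs
  have h1 : s.settled G = 0 := by simp [QState.settled, hs]
  have h2 : (disagreeIn G l s.R : ℝ) = 2 * cost G l := by
    have := two_mul_cost G l
    rw [← Finset.univ_product_univ] at this
    exact_mod_cast this.symm
  have h3 : decay ((n : ℝ) ^ 2) (adjIn G s.R) s.roundsLeft ≤ (n : ℝ) ^ 3 / Q := by
    have hQ' : (0 : ℝ) < Q := by exact_mod_cast hQ
    rcases n.eq_zero_or_pos with rfl | hn
    · simp [decay]
    have hn' : (0 : ℝ) < n := by exact_mod_cast hn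
    have hM : (adjIn G s.R : ℝ) ≤ (n : ℝ) ^ 2 := by
      have : adjIn G s.R ≤ n ^ 2 := by simpa [hs] using adjIn_le G s.R
      exact_mod_cast this
    have hM0 : (0 : ℝ) ≤ adjIn G s.R := Nat.cast_nonneg _
    have hk := roundsLeft_nonneg s
    have hk' : (Q : ℝ) / n - 1 ≤ s.roundsLeft := le_max_right _ _
    have hk'' : (Q : ℝ) ≤ n * (s.roundsLeft + 1) := by
      rw [mul_comm, ← div_le_iff₀ hn']
      linarith
    unfold decay
    rw [div_le_div_iff₀ (by positivity) hQ']
    calc (n : ℝ) ^ 2 * adjIn G s.R * Q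
        ≤ (n : ℝ) ^ 2 * adjIn G s.R * (n * (s.roundsLeft + 1)) := by gcongr
      _ = (n : ℝ) ^ 3 * (adjIn G s.R + s.roundsLeft * adjIn G s.R) := by ring
      _ ≤ _ := by gcongr
  have h4 : (n : ℝ) ^ 3 / (2 * Q) = (n : ℝ) ^ 3 / Q / 2 := by
    rw [mul_comm, div_div]
  rw [potential, h1, h2, h4]
  push_cast
  linarith

theorem exists_cost_eq_opt (G : SimpleGraph (Fin n)) : ∃ l, cost G l = opt G :=
  Nat.sInf_mem (Set.range_nonempty fun l : Fin n → ℕ => cost G l)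

theorem expect_cost_qecc_le (G : SimpleGraph (Fin n)) {Q : ℕ} (hQ : 0 < Q) :
    expect (qecc G Q) (fun r => (cost G r.1 : ℝ≥0∞)) ≤
      3 * (opt G : ℝ≥0∞) + (n : ℝ≥0∞) ^ 3 / (2 * (Q : ℝ≥0∞)) := by
  obtain ⟨l, hl⟩ := exists_cost_eq_opt G
  rw [qecc, expect_map]
  refine (expect_qeccLoop_le G QState.LabelsSettled
    (fun s => ENNReal.ofReal (potential G l s)) _ (fun s hs _ v _ => hs.pivotRound G v)
    ?_ ?_ _ ?_).trans ?_
  · intro s hs hc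
    rw [← ENNReal.ofReal_sum_of_nonneg fun v _ => potential_nonneg G l _,
      ← ENNReal.ofReal_natCast, ← ENNReal.ofReal_mul (Nat.cast_nonneg _)]
    exact ENNReal.ofReal_le_ofReal (sum_potential_le G l hs hc)
  · intro s _ hc
    change (cost G s.output : ℝ≥0∞) ≤ _
    rw [← ENNReal.ofReal_natCast]
    exact ENNReal.ofReal_le_ofReal (cost_output_le_potential G l hc)
  · intro u hu
    exact absurd (Finset.mem_univ u) hu
  · refine (ENNReal.ofReal_le_ofReal (potential_initial_le G l hQ _ _)).trans ?_
    have hQ' : (0 : ℝ) < Q := by exact_mod_cast hQ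
    rw [ENNReal.ofReal_add (by positivity) (by positivity), ENNReal.ofReal_div_of_pos (by positivity),
      ENNReal.ofReal_mul (by positivity), ENNReal.ofReal_mul (by positivity),
      ENNReal.ofReal_pow (by positivity), ENNReal.ofReal_natCast, ENNReal.ofReal_natCast,
      ENNReal.ofReal_natCast, hl]
    simp

/-! ### A program for QECC -/

/-- Registers: `2` the number `r` of unclustered vertices, `3` the constant one, `4` the constant
zero, `5` the loop counter, `6` an address, `7` the pivot, `8` its successor, `9` the number of
vertices kept, `10` the current vertex, `11` scratch. The unclustered vertices are held in the
memory cells `n, …, n + r - 1`. -/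
def qeccProgram : List Instr :=
  [.const 3 1,
    .add 2 1 3,
    .jumpLt 2 0 37,
    .const 2 0,
    -- position 4: write the list of all vertices
    .jumpLt 2 0 6,
    .jump 10,
    .add 6 0 2,
    .store 6 2,
    .add 2 2 3,
    .jump 4,
    -- position 10: main loop
    .jumpLt 4 2 12,
    .jump 37,
    .sub 11 2 3,
    .jumpLt 1 11 37,
    .sub 1 1 11,
    .rand 6 2,
    .add 6 0 6,
    .load 7 6,
    .add 8 7 3,
    .const 5 0,
    .const 9 0,
    -- position 21: form the cluster of the pivot and compress the list
    .jumpLt 5 2 24,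
    .move 2 9,
    .jump 10,
    .add 6 0 5,
    .load 10 6,
    .add 5 5 3,
    .jumpLt 10 7 31,
    .jumpLt 7 10 31,
    .store 10 8,
    .jump 21,
    .query 11 7 10,
    .jumpLt 4 11 29,
    .add 6 0 9,
    .store 6 10,
    .add 9 9 3,
    .jump 21]

/-! ### Composing runs of the machine -/

theorem run_succ (P : List Instr) (O : ℕ → ℕ → ℕ) (t : ℕ) (c : Config) :
    run P O (t + 1) c = (step P O c).bind (run P O t) := rfl

theorem run_add (P : List Instr) (O : ℕ → ℕ → ℕ) (a b : ℕ) (c : Config) :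
    run P O (a + b) c = (run P O a c).bind (run P O b) := by
  induction a generalizing c with
  | zero => simp [run]
  | succ a ih =>
    rw [Nat.add_right_comm, run_succ, run_succ, PMF.bind_bind]
    exact congrArg _ (funext ih)

theorem run_of_halted {P : List Instr} (O : ℕ → ℕ → ℕ) (t : ℕ) {c : Config} (h : Halted P c) :
    run P O t c = PMF.pure c := by
  induction t with
  | zero => rfl
  | succ t ih =>
    rw [run_succ, step, List.getElem?_eq_none h]
    simp [ih]

theorem edgeOracle_val (G : SimpleGraph (Fin n)) (u v : Fin n) [Decidable (G.Adj u v)] :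
    edgeOracle G u v = if G.Adj u v then 1 else 0 := by
  simp [edgeOracle]

/-- From `c`, the program reaches `c'` within `b` steps, whatever the random choices. -/
def Reaches (P : List Instr) (O : ℕ → ℕ → ℕ) (b : ℕ) (c c' : Config) : Prop :=
  ∃ k ≤ b, run P O k c = PMF.pure c'

theorem Reaches.trans {P : List Instr} {O : ℕ → ℕ → ℕ} {a b : ℕ} {c₁ c₂ c₃ : Config}
    (h : Reaches P O a c₁ c₂) (h' : Reaches P O b c₂ c₃) : Reaches P O (a + b) c₁ c₃ := by
  obtain ⟨k, hk, e⟩ := h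
  obtain ⟨k', hk', e'⟩ := h'
  exact ⟨k + k', add_le_add hk hk', by rw [run_add, e, PMF.pure_bind, e']⟩

theorem Reaches.refl (P : List Instr) (O : ℕ → ℕ → ℕ) (c : Config) : Reaches P O 0 c c :=
  ⟨0, le_rfl, rfl⟩

/-- Only bounds on step counts are tracked, so what is known after a block is that at least `T - b`
steps are left. -/
theorem Reaches.run_eq {P : List Instr} {O : ℕ → ℕ → ℕ} {b T : ℕ} {c c' : Config}
    (h : Reaches P O b c c') (hT : b ≤ T) :
    ∃ T' ≤ T, T ≤ T' + b ∧ run P O T c = run P O T' c' := by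
  obtain ⟨k, hk, e⟩ := h
  refine ⟨T - k, Nat.sub_le _ _, by omega, ?_⟩
  obtain ⟨t, rfl⟩ := Nat.exists_eq_add_of_le (hk.trans hT)
  rw [run_add, e, PMF.pure_bind, Nat.add_sub_cancel_left]

theorem Reaches.run_eq_pure {P : List Instr} {O : ℕ → ℕ → ℕ} {b T : ℕ} {c c' : Config}
    (h : Reaches P O b c c') (hT : b ≤ T) (hc : Halted P c') : run P O T c = PMF.pure c' := by
  obtain ⟨T', -, -, e⟩ := h.run_eq hT
  rw [e, run_of_halted O T' hc]

/-! ### Symbolic execution of the blocks of the program -/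

section Blocks

variable (O : ℕ → ℕ → ℕ) (reg mem : ℕ → ℕ) (q : Multiset (Sym2 ℕ))

theorem reaches_scan_pivot (h : reg 5 < reg 2) (hw : mem (reg 0 + reg 5) = reg 7) :
    ∃ reg', Reaches qeccProgram O 12 ⟨21, reg, mem, q⟩
      ⟨21, reg', Function.update mem (mem (reg 0 + reg 5)) (reg 8), q⟩ ∧
      reg' 5 = reg 5 + reg 3 ∧ reg' 9 = reg 9 ∧
      ∀ i ∈ [0, 1, 2, 3, 4, 7, 8], reg' i = reg i := by
  refine ⟨Function.update (Function.update (Function.update reg 6 (reg 0 + reg 5)) 10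
    (mem (reg 0 + reg 5))) 5 (reg 5 + reg 3), ⟨8, by norm_num, ?_⟩, ?_⟩
  · simp [run, step, qeccProgram, Instr.exec, Config.set, h, hw]
  · simp

theorem reaches_scan_cluster (h : reg 5 < reg 2) (hw : mem (reg 0 + reg 5) ≠ reg 7)
    (h0 : reg 4 = 0) (hO : O (reg 7) (mem (reg 0 + reg 5)) = 1) :
    ∃ reg', Reaches qeccProgram O 12 ⟨21, reg, mem, q⟩
      ⟨21, reg', Function.update mem (mem (reg 0 + reg 5)) (reg 8),
        s(reg 7, mem (reg 0 + reg 5)) ::ₘ q⟩ ∧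
      reg' 5 = reg 5 + reg 3 ∧ reg' 9 = reg 9 ∧
      ∀ i ∈ [0, 1, 2, 3, 4, 7, 8], reg' i = reg i := by
  refine ⟨Function.update (Function.update (Function.update (Function.update reg 6 (reg 0 + reg 5))
    10 (mem (reg 0 + reg 5))) 5 (reg 5 + reg 3)) 11 1, ?_, ?_⟩
  -- Inequality with the pivot is tested by two comparisons; the second costs one more step when the
  -- first fails.
  · rcases lt_or_gt_of_ne hw with hw | hw
    · refine ⟨9, by norm_num, ?_⟩
      simp [run, step, qeccProgram, Instr.exec, Config.set, h, hw, h0, hO]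
    · refine ⟨10, by norm_num, ?_⟩
      simp [run, step, qeccProgram, Instr.exec, Config.set, h, hw, hw.not_gt, h0, hO]
  · simp

theorem reaches_scan_keep (h : reg 5 < reg 2) (hw : mem (reg 0 + reg 5) ≠ reg 7)
    (h0 : reg 4 = 0) (hO : O (reg 7) (mem (reg 0 + reg 5)) = 0) :
    ∃ reg', Reaches qeccProgram O 12 ⟨21, reg, mem, q⟩
      ⟨21, reg', Function.update mem (reg 0 + reg 9) (mem (reg 0 + reg 5)),
        s(reg 7, mem (reg 0 + reg 5)) ::ₘ q⟩ ∧
      reg' 5 = reg 5 + reg 3 ∧ reg' 9 = reg 9 + reg 3 ∧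
      ∀ i ∈ [0, 1, 2, 3, 4, 7, 8], reg' i = reg i := by
  refine ⟨Function.update (Function.update (Function.update (Function.update (Function.update
    (Function.update reg 6 (reg 0 + reg 5)) 10 (mem (reg 0 + reg 5))) 5 (reg 5 + reg 3)) 11 0)
    6 (reg 0 + reg 9)) 9 (reg 9 + reg 3), ?_, ?_⟩
  · rcases lt_or_gt_of_ne hw with hw | hw
    · refine ⟨11, by norm_num, ?_⟩
      simp [run, step, qeccProgram, Instr.exec, Config.set, h, hw, h0, hO]
    · refine ⟨12, by norm_num, ?_⟩
      simp [run, step, qeccProgram, Instr.exec, Config.set, h, hw, hw.not_gt, h0, hO]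
  · simp

theorem reaches_scan_end (h : ¬ reg 5 < reg 2) :
    Reaches qeccProgram O 3 ⟨21, reg, mem, q⟩ ⟨10, Function.update reg 2 (reg 9), mem, q⟩ :=
  ⟨3, le_rfl, by simp [run, step, qeccProgram, Instr.exec, Config.set, h]⟩

theorem run_choose_pivot (h : reg 4 < reg 2) (h' : ¬ reg 1 < reg 2 - reg 3) :
    run qeccProgram O 10 ⟨10, reg, mem, q⟩ = (uniformBelow (reg 2)).bind fun j =>
      PMF.pure ⟨21, Function.update (Function.update (Function.update (Function.update
        (Function.update (Function.update (Function.update reg 11 (reg 2 - reg 3)) 1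
        (reg 1 - (reg 2 - reg 3))) 6 (reg 0 + j)) 7 (mem (reg 0 + j))) 8
        (mem (reg 0 + j) + reg 3)) 5 0) 9 0, mem, q⟩ := by
  simp [run, step, qeccProgram, Instr.exec, Config.set, h, h', PMF.bind_map, Function.comp_def]

theorem reaches_end_of_empty (h : ¬ reg 4 < reg 2) :
    Reaches qeccProgram O 3 ⟨10, reg, mem, q⟩ ⟨37, reg, mem, q⟩ :=
  ⟨2, by norm_num, by simp [run, step, qeccProgram, Instr.exec, h]⟩

theorem reaches_end_of_budget (h : reg 4 < reg 2) (h' : reg 1 < reg 2 - reg 3) :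
    Reaches qeccProgram O 3 ⟨10, reg, mem, q⟩
      ⟨37, Function.update reg 11 (reg 2 - reg 3), mem, q⟩ :=
  ⟨3, le_rfl, by simp [run, step, qeccProgram, Instr.exec, Config.set, h, h']⟩

theorem reaches_list_vertex (h : reg 2 < reg 0) :
    ∃ reg', Reaches qeccProgram O 5 ⟨4, reg, mem, q⟩
      ⟨4, reg', Function.update mem (reg 0 + reg 2) (reg 2), q⟩ ∧
      reg' 2 = reg 2 + reg 3 ∧ ∀ i ∈ [0, 1, 3, 4], reg' i = reg i := by
  refine ⟨Function.update (Function.update reg 6 (reg 0 + reg 2)) 2 (reg 2 + reg 3),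
    ⟨5, le_rfl, ?_⟩, ?_⟩
  · simp [run, step, qeccProgram, Instr.exec, Config.set, h]
  · simp

theorem reaches_list_end (h : ¬ reg 2 < reg 0) :
    Reaches qeccProgram O 2 ⟨4, reg, mem, q⟩ ⟨10, reg, mem, q⟩ :=
  ⟨2, le_rfl, by simp [run, step, qeccProgram, Instr.exec, h]⟩

/-- Writing the vertex list takes time of order `n`, which need not be `O(Q)`. A budget too small
for the first round must therefore be detected beforehand. -/
theorem reaches_start_halt (h : reg 1 + 1 < reg 0) :
    ∃ reg', Reaches qeccProgram O 3 ⟨0, reg, mem, q⟩ ⟨37, reg', mem, q⟩ :=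
  ⟨Function.update (Function.update reg 3 1) 2 (reg 1 + 1), 3, le_rfl, by
    simp [run, step, qeccProgram, Instr.exec, Config.set, h]⟩

theorem reaches_start_list (h : ¬ reg 1 + 1 < reg 0) :
    ∃ reg', Reaches qeccProgram O 4 ⟨0, reg, mem, q⟩ ⟨4, reg', mem, q⟩ ∧
      reg' 2 = 0 ∧ reg' 3 = 1 ∧ ∀ i ∈ [0, 1, 4], reg' i = reg i := by
  refine ⟨Function.update (Function.update (Function.update reg 3 1) 2 (reg 1 + 1)) 2 0,
    ⟨4, le_rfl, ?_⟩, ?_⟩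
  · simp [run, step, qeccProgram, Instr.exec, Config.set, h]
  · simp

end Blocks

/-! ### Invariants linking the machine to the algorithm -/

/-- The vertices of `L` outside the cluster of `v`. -/
noncomputable def keptVertices (G : SimpleGraph (Fin n)) (R : Finset (Fin n)) (v : Fin n)
    (L : List (Fin n)) : List (Fin n) :=
  L.filter fun u => u ∉ pivotCluster G R v

/-- The queries made when the vertices of `L` are compared with `v`. -/
def scanQueries (v : Fin n) (L : List (Fin n)) : Multiset (Sym2 ℕ) :=
  ((L.filter fun u => u ≠ v).map fun u : Fin n => s((v : ℕ), (u : ℕ)) : List (Sym2 ℕ))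

theorem scanQueries_append (v : Fin n) (L : List (Fin n)) (w : Fin n) :
    scanQueries v (L ++ [w]) =
      if w = v then scanQueries v L else s((v : ℕ), (w : ℕ)) ::ₘ scanQueries v L := by
  by_cases h : w = v
  · simp [scanQueries, List.filter_append, h]
  · simp only [scanQueries, List.filter_append, h, if_false, List.map_append]
    rw [← Multiset.coe_add, add_comm]
    simp [h]

/-- At position `10`, the machine is in the state `s` and holds the list `L` of the unclustered
vertices. -/
structure AtLoop (s : QState n) (L : List (Fin n)) (c : Config) : Prop where
  pc : c.pc = 10
  reg0 : c.reg 0 = n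
  reg1 : c.reg 1 = s.budget
  reg2 : c.reg 2 = L.length
  reg3 : c.reg 3 = 1
  reg4 : c.reg 4 = 0
  nodup : L.Nodup
  mem_iff : ∀ u, u ∈ L ↔ u ∈ s.R
  cell : ∀ i u, L[i]? = some u → c.mem (n + i) = (u : Fin n)
  label : ∀ u : Fin n, c.mem u = if u ∈ s.R then 0 else s.label u + 1
  queries : c.queries = s.queries.map (Sym2.map Fin.val)

/-- At position `21`, with the pivot `v`, the vertices in `seen` have been compared with the pivot,
and those in `rest` have not. -/
structure AtScan (G : SimpleGraph (Fin n)) (s : QState n) (v : Fin n) (seen rest : List (Fin n))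
    (c : Config) : Prop where
  pc : c.pc = 21
  reg0 : c.reg 0 = n
  reg1 : c.reg 1 = s.budget - (s.R.card - 1)
  reg2 : c.reg 2 = seen.length + rest.length
  reg3 : c.reg 3 = 1
  reg4 : c.reg 4 = 0
  reg5 : c.reg 5 = seen.length
  reg7 : c.reg 7 = v
  reg8 : c.reg 8 = v + 1
  reg9 : c.reg 9 = (keptVertices G s.R v seen).length
  kept : ∀ i u, (keptVertices G s.R v seen)[i]? = some u → c.mem (n + i) = (u : Fin n)
  cell : ∀ i u, rest[i]? = some u → c.mem (n + (seen.length + i)) = (u : Fin n)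
  label : ∀ u : Fin n, c.mem u =
    if u ∈ seen ∧ u ∈ pivotCluster G s.R v then (v : ℕ) + 1 else if u ∈ s.R then 0 else s.label u + 1
  queries : c.queries = s.queries.map (Sym2.map Fin.val) + scanQueries v seen

variable {G : SimpleGraph (Fin n)} {s : QState n} {v : Fin n} {seen rest : List (Fin n)}

theorem keptVertices_append (w : Fin n) : keptVertices G s.R v (seen ++ [w]) =
    if w ∈ pivotCluster G s.R v then keptVertices G s.R v seen
    else keptVertices G s.R v seen ++ [w] := by
  by_cases h : w ∈ pivotCluster G s.R v <;> simp [keptVertices, List.filter_append, h]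

/-- A vertex that joins the cluster of the pivot. -/
theorem AtScan.of_mem_cluster {w : Fin n} {c c' : Config} (h : AtScan G s v seen (w :: rest) c)
    (hw : w ∈ pivotCluster G s.R v) (hpc : c'.pc = 21)
    (hmem : c'.mem = Function.update c.mem w (v + 1))
    (hq : c'.queries = if w = v then c.queries else s((v : ℕ), (w : ℕ)) ::ₘ c.queries)
    (h5 : c'.reg 5 = c.reg 5 + c.reg 3) (h9 : c'.reg 9 = c.reg 9)
    (hreg : ∀ i ∈ [0, 1, 2, 3, 4, 7, 8], c'.reg i = c.reg i) :
    AtScan G s v (seen ++ [w]) rest c' where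
  pc := hpc
  reg0 := by rw [hreg 0 (by simp), h.reg0]
  reg1 := by rw [hreg 1 (by simp), h.reg1]
  reg2 := by
    rw [hreg 2 (by simp), h.reg2, List.length_append, List.length_cons, List.length_singleton]
    omega
  reg3 := by rw [hreg 3 (by simp), h.reg3]
  reg4 := by rw [hreg 4 (by simp), h.reg4]
  reg5 := by rw [h5, h.reg5, h.reg3, List.length_append, List.length_singleton]
  reg7 := by rw [hreg 7 (by simp), h.reg7]
  reg8 := by rw [hreg 8 (by simp), h.reg8]
  reg9 := by rw [h9, h.reg9, keptVertices_append, if_pos hw]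
  kept i u hu := by
    rw [keptVertices_append, if_pos hw] at hu
    rw [hmem, Function.update_of_ne (by omega), h.kept i u hu]
  cell i u hu := by
    rw [hmem, Function.update_of_ne (by omega), List.length_append, List.length_singleton,
      add_assoc, Nat.add_comm 1 i]
    exact h.cell (i + 1) u (by simpa using hu)
  label u := by
    rw [hmem]
    by_cases huw : u = w
    · subst huw
      simp [hw]
    · rw [Function.update_of_ne (by rwa [Ne, Fin.val_inj]), h.label]
      simp [huw]
  queries := by
    rw [hq, h.queries, scanQueries_append]
    split_ifs
    · rfl
    · rw [Multiset.add_cons]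

/-- A vertex that is kept. -/
theorem AtScan.of_notMem_cluster {w : Fin n} {c c' : Config}
    (h : AtScan G s v seen (w :: rest) c)
    (hw : w ∉ pivotCluster G s.R v) (hpc : c'.pc = 21)
    (hmem : c'.mem = Function.update c.mem (n + c.reg 9) w)
    (hq : c'.queries = s((v : ℕ), (w : ℕ)) ::ₘ c.queries)
    (h5 : c'.reg 5 = c.reg 5 + c.reg 3) (h9 : c'.reg 9 = c.reg 9 + c.reg 3)
    (hreg : ∀ i ∈ [0, 1, 2, 3, 4, 7, 8], c'.reg i = c.reg i) :
    AtScan G s v (seen ++ [w]) rest c' where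
  pc := hpc
  reg0 := by rw [hreg 0 (by simp), h.reg0]
  reg1 := by rw [hreg 1 (by simp), h.reg1]
  reg2 := by
    rw [hreg 2 (by simp), h.reg2, List.length_append, List.length_cons, List.length_singleton]
    omega
  reg3 := by rw [hreg 3 (by simp), h.reg3]
  reg4 := by rw [hreg 4 (by simp), h.reg4]
  reg5 := by rw [h5, h.reg5, h.reg3, List.length_append, List.length_singleton]
  reg7 := by rw [hreg 7 (by simp), h.reg7]
  reg8 := by rw [hreg 8 (by simp), h.reg8]
  reg9 := by
    rw [h9, h.reg9, h.reg3, keptVertices_append, if_neg hw, List.length_append,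
      List.length_singleton]
  kept i u hu := by
    rw [keptVertices_append, if_neg hw] at hu
    rw [hmem, h.reg9]
    rcases lt_trichotomy i (keptVertices G s.R v seen).length with hi | hi | hi
    · rw [List.getElem?_append_left hi] at hu
      rw [Function.update_of_ne (by omega), h.kept i u hu]
    · rw [hi] at hu ⊢
      rw [List.getElem?_concat_length, Option.some_inj] at hu
      rw [Function.update_self, hu]
    · rw [List.getElem?_eq_none (by rw [List.length_append, List.length_singleton]; omega)] at hu
      cases hu
  cell i u hu := by
    -- No more vertices have been kept than seen, so the in-place write falls before every cell
    -- still to be read.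
    have := List.length_filter_le (fun u => decide (u ∉ pivotCluster G s.R v)) seen
    rw [hmem, h.reg9, List.length_append, List.length_singleton, add_assoc, Nat.add_comm 1 i,
      Function.update_of_ne (by rw [keptVertices]; omega)]
    exact h.cell (i + 1) u (by simpa using hu)
  label u := by
    rw [hmem, Function.update_of_ne (by omega), h.label]
    by_cases huw : u = w
    · subst huw
      simp [hw]
    · simp [huw]
  queries := by
    have hwv : w ≠ v := fun h => hw (h ▸ mem_pivotCluster.2 (Or.inl rfl))
    rw [hq, h.queries, scanQueries_append, if_neg hwv, Multiset.add_cons]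

theorem AtScan.next {w : Fin n} {c : Config} (h : AtScan G s v seen (w :: rest) c)
    (hw : w ∈ s.R) : ∃ c', Reaches qeccProgram (edgeOracle G) 12 c c' ∧
      AtScan G s v (seen ++ [w]) rest c' := by
  classical
  obtain ⟨pc, reg, mem, q⟩ := c
  have e0 : reg 0 = n := h.reg0
  have e4 : reg 4 = 0 := h.reg4
  have e5 : reg 5 = seen.length := h.reg5
  have e7 : reg 7 = v := h.reg7
  have e8 : reg 8 = (v : ℕ) + 1 := h.reg8
  obtain rfl : pc = 21 := h.pc
  have h52 : reg 5 < reg 2 := by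
    have : reg 2 = seen.length + (w :: rest).length := h.reg2
    rw [this, e5, List.length_cons]
    omega
  have hcell : mem (reg 0 + reg 5) = w := by
    rw [e0, e5]
    exact h.cell 0 w rfl
  by_cases hwv : w = v
  · obtain ⟨reg', hr, h5, h9, hreg⟩ := reaches_scan_pivot (edgeOracle G) reg mem q h52
      (by rw [hcell, e7, hwv])
    refine ⟨_, hr, h.of_mem_cluster (mem_pivotCluster.2 (Or.inl hwv)) rfl ?_ ?_ h5 h9 hreg⟩
    · simp only [hcell, e8]
    · simp [hwv]
  · have hne : mem (reg 0 + reg 5) ≠ reg 7 := by rwa [hcell, e7, Ne, Fin.val_inj]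
    have ho := edgeOracle_val G v w
    by_cases ha : G.Adj v w
    · obtain ⟨reg', hr, h5, h9, hreg⟩ := reaches_scan_cluster (edgeOracle G) reg mem q h52 hne e4
        (by rw [e7, hcell, ho, if_pos ha])
      refine ⟨_, hr, h.of_mem_cluster (mem_pivotCluster.2 (Or.inr ⟨hw, ha⟩)) rfl ?_ ?_ h5 h9 hreg⟩
      · simp only [hcell, e8]
      · simp [hwv, hcell, e7]
    · obtain ⟨reg', hr, h5, h9, hreg⟩ := reaches_scan_keep (edgeOracle G) reg mem q h52 hne e4
        (by rw [e7, hcell, ho, if_neg ha])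
      refine ⟨_, hr, h.of_notMem_cluster ?_ rfl ?_ ?_ h5 h9 hreg⟩
      · rw [mem_pivotCluster]
        tauto
      · change Function.update mem (reg 0 + reg 9) _ = Function.update mem (n + reg 9) _
        rw [hcell, e0]
      · simp only [hcell, e7]

theorem AtScan.finish {c : Config} (h : AtScan G s v seen rest c) (hrest : ∀ w ∈ rest, w ∈ s.R) :
    ∃ c', Reaches qeccProgram (edgeOracle G) (12 * rest.length) c c' ∧
      AtScan G s v (seen ++ rest) [] c' := by
  induction rest generalizing seen c with
  | nil => exact ⟨c, Reaches.refl _ _ _, by simpa using h⟩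
  | cons w rest ih =>
    obtain ⟨c₁, h₁, hs₁⟩ := h.next (hrest w List.mem_cons_self)
    obtain ⟨c₂, h₂, hs₂⟩ := ih hs₁ fun u hu => hrest u (List.mem_cons_of_mem _ hu)
    refine ⟨c₂, ?_, by simpa using hs₂⟩
    rw [List.length_cons, Nat.mul_succ, Nat.add_comm]
    exact h₁.trans h₂

theorem AtScan.reaches_loop {L : List (Fin n)} {c : Config} (h : AtScan G s v L [] c)
    (hL : L.Nodup) (hmem : ∀ u, u ∈ L ↔ u ∈ s.R) (hv : v ∈ s.R) :
    ∃ c', Reaches qeccProgram (edgeOracle G) 3 c c' ∧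
      AtLoop (pivotRound G s v) (keptVertices G s.R v L) c' := by
  obtain ⟨pc, reg, mem, q⟩ := c
  have e5 : reg 5 = L.length := h.reg5
  have e2 : reg 2 = L.length := h.reg2
  obtain rfl : pc = 21 := h.pc
  refine ⟨_, reaches_scan_end (edgeOracle G) reg mem q (by rw [e5, e2]; exact lt_irrefl _), ?_⟩
  refine
    { pc := rfl
      reg0 := h.reg0
      reg1 := h.reg1
      reg2 := h.reg9
      reg3 := h.reg3
      reg4 := h.reg4
      nodup := hL.filter _
      mem_iff := fun u => by simp [keptVertices, pivotRound, hmem]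
      cell := h.kept
      label := fun u => ?_
      queries := ?_ }
  · refine (h.label u).trans ?_
    have hsub : u ∈ pivotCluster G s.R v → u ∈ s.R := fun hu => pivotCluster_subset hv hu
    simp only [hmem, pivotRound, Finset.mem_sdiff]
    by_cases hu : u ∈ pivotCluster G s.R v
    · simp [hu, hsub hu]
    · simp [hu]
  · refine h.queries.trans ?_
    simp only [pivotRound, Multiset.map_add, Multiset.map_map]
    congr 1
    have : s.R.erase v = (L.filter fun u => u ≠ v).toFinset := by
      ext u
      simp [hmem, and_comm]
    rw [this, List.toFinset_val, (hL.filter _).dedup, Multiset.map_coe, scanQueries]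
    rfl

/-- `L` lists `R` without repetition, so a uniform index is a uniform pivot, whatever the order of
`L`. -/
theorem uniformBelow_bind_eq {β : Type*} {L : List (Fin n)} (hL : L.Nodup) {R : Finset (Fin n)}
    (hmem : ∀ u, u ∈ L ↔ u ∈ R) (hR : R.attach.Nonempty) (F : ℕ → PMF β) (K : Fin n → PMF β)
    (hF : ∀ j u, L[j]? = some u → F j = K u) :
    (uniformBelow L.length).bind F =
      (PMF.uniformOfFinset R.attach hR).bind fun v => K v := by
  obtain rfl : R = L.toFinset := by
    ext u
    simp [hmem]
  have hlen : L.length ≠ 0 := by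
    obtain ⟨⟨u, hu⟩, -⟩ := hR
    exact (List.length_pos_of_mem (List.mem_toFinset.1 hu)).ne'
  ext b
  rw [uniformBelow, dif_neg hlen]
  change expect _ (fun j => F j b) = expect _ fun v : L.toFinset => K v b
  rw [expect_uniformOfFinset, expect_uniformOfFinset, Finset.card_range, Finset.card_attach,
    List.toFinset_card_of_nodup hL, Finset.sum_attach L.toFinset fun v => K v b,
    List.sum_toFinset _ hL, Finset.sum_range, ← Fin.sum_univ_fun_getElem]
  congr 1
  exact Finset.sum_congr rfl fun j _ => by rw [hF j L[j] (by simp)]; rfl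

/-! ### Running time and correctness of the simulation -/

/-- A bound for the running time of the main loop. -/
def QState.timeLeft (s : QState n) : ℕ :=
  37 * s.budget + (if s.R.card = 0 then 0 else 25) + 3

/-- With `r = |R|`, the round takes at most `12 * r + 13 = 12 * (r - 1) + 25` steps. For `r ≥ 2`
this is at most `37 * (r - 1)`, paid by the queries. A round with `r = 1` is free of queries but
empties `R`, so the reserve of 25 is used at most once. -/
theorem timeLeft_pivotRound (h : s.Continues) (hv : v ∈ s.R) :
    10 + 12 * s.R.card + 3 + (pivotRound G s v).timeLeft ≤ s.timeLeft := by
  have h1 := Finset.card_pos.2 h.1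
  have h2 := h.2
  have h3 := pivotRound_card_lt G s hv
  have h4 : (pivotRound G s v).budget = s.budget - (s.R.card - 1) := rfl
  simp only [QState.timeLeft, h4]
  split_ifs <;> omega

/-- What the machine outputs: the clustering and the queries. -/
def Config.outcome (n : ℕ) (c : Config) : (Fin n → ℕ) × Multiset (Sym2 ℕ) :=
  (c.clustering n, c.queries)

/-- What the algorithm outputs: the clustering and the queries. -/
def QState.outcome (s : QState n) : (Fin n → ℕ) × Multiset (Sym2 ℕ) :=
  (s.output, s.queries.map (Sym2.map Fin.val))

theorem outcome_eq {c : Config}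
    (hl : ∀ u : Fin n, c.mem u = if u ∈ s.R then 0 else s.label u + 1)
    (hq : c.queries = s.queries.map (Sym2.map Fin.val)) : c.outcome n = s.outcome := by
  refine Prod.ext (funext fun u => ?_) hq
  simp only [Config.outcome, QState.outcome, Config.clustering, QState.output, hl]
  split_ifs <;> simp_all

theorem AtLoop.card_eq {L : List (Fin n)} {c : Config} (h : AtLoop s L c) :
    L.length = s.R.card := by
  rw [← List.toFinset_card_of_nodup h.nodup]
  congr 1
  ext u
  simp [h.mem_iff]

theorem AtLoop.run_choose {L : List (Fin n)} {c : Config} (h : AtLoop s L c) (hc : s.Continues) :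
    ∃ F : ℕ → Config, run qeccProgram (edgeOracle G) 10 c =
        ((uniformBelow L.length).bind fun j => PMF.pure (F j)) ∧
      ∀ j u, L[j]? = some u → AtScan G s u [] L (F j) := by
  obtain ⟨pc, reg, mem, q⟩ := c
  have e0 : reg 0 = n := h.reg0
  have e1 : reg 1 = s.budget := h.reg1
  have e2 : reg 2 = L.length := h.reg2
  have e3 : reg 3 = 1 := h.reg3
  have e4 : reg 4 = 0 := h.reg4
  have hlen := h.card_eq
  obtain rfl : pc = 10 := h.pc
  have h1 := Finset.card_pos.2 hc.1
  have h2 := hc.2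
  refine ⟨_, (run_choose_pivot (edgeOracle G) reg mem q (by omega) (by omega)).trans
    (by rw [e2]), fun j u hju => ?_⟩
  have hcell : mem (n + j) = u := h.cell j u hju
  exact
    { pc := rfl
      reg0 := e0
      reg1 := by simp [e1, e3, hlen]
      reg2 := by simp [e2]
      reg3 := e3
      reg4 := e4
      reg5 := by simp
      reg7 := by simp [e0, hcell]
      reg8 := by simp [e0, e3, hcell]
      reg9 := by simp [keptVertices]
      kept := by simp [keptVertices]
      cell := by simpa using h.cell
      label := by simpa using h.label
      queries := by simpa [scanQueries] using h.queries }

theorem AtLoop.reaches_end {L : List (Fin n)} {c : Config} (h : AtLoop s L c)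
    (hc : ¬ s.Continues) : ∃ c', Reaches qeccProgram (edgeOracle G) 3 c c' ∧
      Halted qeccProgram c' ∧ c'.outcome n = s.outcome := by
  obtain ⟨pc, reg, mem, q⟩ := c
  have e1 : reg 1 = s.budget := h.reg1
  have e2 : reg 2 = L.length := h.reg2
  have e3 : reg 3 = 1 := h.reg3
  have e4 : reg 4 = 0 := h.reg4
  have hlen := h.card_eq
  obtain rfl : pc = 10 := h.pc
  by_cases hR : s.R.Nonempty
  · have h1 := Finset.card_pos.2 hR
    have h2 : ¬ s.R.card - 1 ≤ s.budget := fun h' => hc ⟨hR, h'⟩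
    exact ⟨_, reaches_end_of_budget _ reg mem q (by omega) (by omega), le_refl 37,
      outcome_eq h.label h.queries⟩
  · have h1 : s.R.card = 0 := by simpa using hR
    exact ⟨_, reaches_end_of_empty _ reg mem q (by omega), le_refl 37,
      outcome_eq h.label h.queries⟩

/-- The main loop of the program simulates the main loop of the algorithm. -/
theorem AtLoop.simulates (G : SimpleGraph (Fin n)) (s : QState n) :
    ∀ (L : List (Fin n)) (c : Config), AtLoop s L c → ∀ T, s.timeLeft ≤ T →
      (∀ c' ∈ (run qeccProgram (edgeOracle G) T c).support, Halted qeccProgram c') ∧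
      (run qeccProgram (edgeOracle G) T c).map (Config.outcome n) =
        (qeccLoop G s).map QState.outcome := by
  induction s using QState.loop_induction G with
  | halt s hs =>
    intro L c h T hT
    obtain ⟨c', hr, hh, ho⟩ := h.reaches_end (G := G) hs
    rw [hr.run_eq_pure (by rw [QState.timeLeft] at hT; omega) hh,
      qeccLoop_of_not_continues G hs, PMF.pure_map, PMF.pure_map, ho]
    simp [PMF.support_pure, hh]
  | round s hs ih =>
    intro L c h T hT
    obtain ⟨F, hF, hscan⟩ := h.run_choose (G := G) hs
    have hlen := h.card_eq
    have key : ∀ j u, L[j]? = some u →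
        (∀ c' ∈ (run qeccProgram (edgeOracle G) (T - 10) (F j)).support,
          Halted qeccProgram c') ∧
        (run qeccProgram (edgeOracle G) (T - 10) (F j)).map (Config.outcome n) =
          (qeccLoop G (pivotRound G s u)).map QState.outcome := by
      intro j u hju
      have hu : u ∈ s.R := (h.mem_iff u).1 (List.mem_of_getElem? hju)
      obtain ⟨c₁, h₁, hs₁⟩ := (hscan j u hju).finish fun w hw => (h.mem_iff w).1 hw
      obtain ⟨c₂, h₂, hs₂⟩ := AtScan.reaches_loop hs₁ h.nodup h.mem_iff hu
      have ht := timeLeft_pivotRound (G := G) hs hu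
      -- `T'` may depend on the pivot; the induction hypothesis holds for every sufficient number of
      -- steps.
      obtain ⟨T', -, hT', e⟩ := (h₁.trans h₂).run_eq (T := T - 10) (by omega)
      rw [e]
      exact ih u hu _ c₂ hs₂ T' (by omega)
    have hT10 : T = 10 + (T - 10) := by
      obtain ⟨v, hv⟩ := hs.1
      have ht := timeLeft_pivotRound (G := G) hs hv
      omega
    have hrun : run qeccProgram (edgeOracle G) T c = (uniformBelow L.length).bind fun j =>
        run qeccProgram (edgeOracle G) (T - 10) (F j) := by
      rw [hT10, run_add, hF, PMF.bind_bind]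
      simp
    have hpos : L.length ≠ 0 := by
      rw [hlen]
      exact (Finset.card_pos.2 hs.1).ne'
    rw [hrun]
    constructor
    · intro c' hc'
      rw [PMF.mem_support_bind_iff] at hc'
      obtain ⟨j, hj, hc'⟩ := hc'
      rw [uniformBelow, dif_neg hpos, PMF.mem_support_uniformOfFinset_iff,
        Finset.mem_range] at hj
      exact (key j L[j] (List.getElem?_eq_getElem hj)).1 c' hc'
    · rw [qeccLoop_of_continues G hs, PMF.map_bind, PMF.map_bind]
      exact uniformBelow_bind_eq h.nodup h.mem_iff _ _
        (fun u => (qeccLoop G (pivotRound G s u)).map QState.outcome) fun j u hju => (key j u hju).2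

/-- The state of the algorithm at the start. -/
def QState.initial (n Q : ℕ) : QState n :=
  { R := Finset.univ, budget := Q, label := fun _ => 0, queries := 0 }

theorem reaches_listing (O : ℕ → ℕ → ℕ) {n Q : ℕ} (h : n ≤ Q + 1) {i : ℕ} (hi : i ≤ n) :
    ∃ reg mem, Reaches qeccProgram O (4 + 5 * i) (start n Q) ⟨4, reg, mem, 0⟩ ∧
      reg 2 = i ∧ reg 0 = n ∧ reg 1 = Q ∧ reg 3 = 1 ∧ reg 4 = 0 ∧
      (∀ k < i, mem (n + k) = k) ∧ ∀ k < n, mem k = 0 := by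
  induction i with
  | zero =>
    obtain ⟨reg, hr, h2, h3, hreg⟩ := reaches_start_list O (start n Q).reg (start n Q).mem 0
      (by simp [start, h])
    exact ⟨reg, fun _ => 0, hr, h2, hreg 0 (by simp), hreg 1 (by simp), h3, hreg 4 (by simp),
      by simp, by simp⟩
  | succ i ih =>
    obtain ⟨reg, mem, hr, h2, h0, h1, h3, h4, hm, hm'⟩ := ih (by omega)
    obtain ⟨reg', hr', h2', hreg⟩ := reaches_list_vertex O reg mem 0 (by omega)
    refine ⟨reg', _, hr.trans hr', by omega, by rw [hreg 0 (by simp), h0],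
      by rw [hreg 1 (by simp), h1], by rw [hreg 3 (by simp), h3], by rw [hreg 4 (by simp), h4],
      fun k hk => ?_, fun k hk => ?_⟩
    · rw [h0, h2]
      rcases (Nat.lt_succ_iff.1 hk).eq_or_lt with rfl | hk
      · simp
      · rw [Function.update_of_ne (by omega), hm k hk]
    · rw [h0, Function.update_of_ne (by omega), hm' k hk]

theorem reaches_atLoop (O : ℕ → ℕ → ℕ) {n Q : ℕ} (h : n ≤ Q + 1) :
    ∃ c, Reaches qeccProgram O (4 + 5 * n + 2) (start n Q) c ∧
      AtLoop (QState.initial n Q) (List.finRange n) c := by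
  obtain ⟨reg, mem, hr, h2, h0, h1, h3, h4, hm, hm'⟩ := reaches_listing O h le_rfl
  refine ⟨_, hr.trans (reaches_list_end O reg mem 0 (by omega)), ?_⟩
  exact
    { pc := rfl
      reg0 := h0
      reg1 := h1
      reg2 := by simp [h2]
      reg3 := h3
      reg4 := h4
      nodup := List.nodup_finRange n
      mem_iff := by simp [QState.initial]
      cell := by
        intro i u hu
        obtain ⟨hi, rfl⟩ := List.getElem?_eq_some_iff.1 hu
        rw [List.length_finRange] at hi
        simpa using hm i hi
      label := fun u => by simp [QState.initial, hm' u u.2]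
      queries := by simp [QState.initial] }

theorem map_outcome_eq (G : SimpleGraph (Fin n)) (Q : ℕ) :
    (qecc G Q).map (fun r => (r.1, r.2.map (Sym2.map Fin.val))) =
      (qeccLoop G (QState.initial n Q)).map QState.outcome := by
  rw [qecc, PMF.map_comp]
  rfl

/-- When `n ≤ Q + 1`, setup takes at most `5 * n + 6 ≤ 5 * Q + 11` steps and the loop at most `37 *
Q + 28`. The total `42 * Q + 39` is at most `81 * Q` because `Q ≥ 1`. -/
theorem implementsQECC_qeccProgram : ImplementsQECC qeccProgram fun _ Q => 81 * Q := by
  intro n Q hQ G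
  rw [map_outcome_eq]
  by_cases h : n ≤ Q + 1
  · obtain ⟨c, hr, hc⟩ := reaches_atLoop (edgeOracle G) h
    obtain ⟨T, -, hT, e⟩ := hr.run_eq (T := 81 * Q) (by omega)
    have hb : (QState.initial n Q).budget = Q := rfl
    have := AtLoop.simulates G _ _ c hc T (by
      rw [QState.timeLeft, hb]
      split_ifs <;> omega)
    rw [e]
    exact this
  · obtain ⟨reg, hr⟩ := reaches_start_halt (edgeOracle G) (start n Q).reg (start n Q).mem 0
      (by simp [start]; omega)
    have hh : Halted qeccProgram ⟨37, reg, (start n Q).mem, 0⟩ := le_refl 37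
    have hs : ¬ (QState.initial n Q).Continues := by
      rintro ⟨-, h'⟩
      simp only [QState.initial, Finset.card_univ, Fintype.card_fin] at h'
      omega
    have e := hr.run_eq_pure (T := 81 * Q) (by omega) hh
    change run qeccProgram (edgeOracle G) (81 * Q) (start n Q) = _ at e
    rw [e, qeccLoop_of_not_continues G hs]
    refine ⟨by simp [PMF.support_pure, hh], ?_⟩
    change PMF.map (Config.outcome n) _ = _
    rw [PMF.pure_map, PMF.pure_map]
    congr 1
    exact outcome_eq (by simp [QState.initial, start]) rfl

end CorrClust

theorem theorem1 :
    (∀ (n Q : ℕ), 0 < Q → ∀ G : SimpleGraph (Fin n),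
      (∀ r ∈ (CorrClust.qecc G Q).support, Multiset.card r.2 ≤ Q) ∧
      CorrClust.expect (CorrClust.qecc G Q) (fun r => (CorrClust.cost G r.1 : ENNReal)) ≤
        3 * (CorrClust.opt G : ENNReal) + (n : ENNReal) ^ 3 / (2 * (Q : ENNReal))) ∧
    ∃ (P : List CorrClust.Instr) (C : ℕ),
      CorrClust.ImplementsQECC P (fun _ Q => C * Q) :=
  ⟨fun _ Q hQ G => ⟨CorrClust.card_queries_le G Q, CorrClust.expect_cost_qecc_le G hQ⟩,
    CorrClust.qeccProgram, 81, CorrClust.implementsQECC_qeccProgram⟩
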